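/- For $n\ge 0$ let $Q_n$ be the hypercube graph on $\{0,1\}^n$ (two binary strings are adjacent when they differ in exactly one coordinate). A labeling of the vertices of a graph with two labels is $2$-distinguishing if only the trivial automorphism of the graph preserves the labels; for $n\ge 4$ such labelings of $Q_n$ exist, and the cost $\rho(Q_n)$ is the minimum size of a label class over all $2$-distinguishing labelings of $Q_n$. Let $X$ be a binary $m\times n$ matrix. A symmetry of $X$ is a pair $(\sigma,\varphi)$, where $\sigma$ is a permutation of the rows and $\varphi=(\pi,\{\psi_i\})$ consists of a permutation $\pi$ of the columns and, for each column $i$, a bijection $\psi_i$ of $\{0,1\}$ applied to every entry of column $i$, such that permuting the rows of $X$ by $\sigma$ gives the same matrix as applying $\varphi$ to the columns of $X$. The matrix $X$ is asymmetric if its only symmetry is the trivial one. For $m\ge 5$ let $\nu_m$ be the smallest $n$ for which there is an asymmetric binary $m\times n$ matrix. **Theorem.** For every integer $m$ with $5\le m\le 11$, $\nu_m=4$. For every integer $m\ge 12$ there is a unique integer $n\ge 5$ with $$2^{n-1}-\rho(Q_{n-1})+1\;\le\; m\;\le\; 2^{n}-\rho(Q_n),$$ and $\nu_m=n$ for this $n$.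 -/

import Mathlib

namespace Hypercube

/-- The `n`-dimensional hypercube `Q_n`: the vertices are the binary strings of length `n`, and two
of them are adjacent when they differ in exactly one coordinate. -/
def Q (n : ℕ) : SimpleGraph (Fin n → Bool) where
  Adj v w := ∃! i, v i ≠ w i
  symm := ⟨by
    rintro v w ⟨i, hi, h⟩
    exact ⟨i, Ne.symm hi, fun j hj => h j (Ne.symm hj)⟩⟩
  loopless := ⟨by
    rintro v ⟨i, hi, _⟩
    exact hi rfl⟩

/-- A `d`-labeling `c` of the vertices of `G` is distinguishing when only the trivial automorphism
of `G` preserves the labels. -/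
def IsDistinguishing {V : Type*} (G : SimpleGraph V) {d : ℕ} (c : V → Fin d) : Prop :=
  ∀ φ : G ≃g G, (∀ v, c (φ v) = c v) → ∀ v, φ v = v

/-- `S` is a distinguishing class of `G`: a label class of a `2`-distinguishing labeling. -/
def IsDistinguishingClass {V : Type*} (G : SimpleGraph V) (S : Set V) : Prop :=
  ∃ c : V → Fin 2, IsDistinguishing G c ∧ ∃ i : Fin 2, S = {v | c v = i}

/-- The cost of `2`-distinguishing `ρ(G)` of a `2`-distinguishable finite graph `G`: the minimum size
of a label class, over all `2`-distinguishing labelings. -/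
noncomputable def cost {V : Type*} [Finite V] (G : SimpleGraph V) : ℕ :=
  sInf {k : ℕ | ∃ S : Set V, IsDistinguishingClass G S ∧ S.ncard = k}

/-- A permaut of `n` binary columns: a permutation `π` of the columns together with, for each
column `i`, a bijection `ψ i` of the two-element set applied to the entries of column `i`. -/
structure Permaut (n : ℕ) where
  π : Equiv.Perm (Fin n)
  ψ : Fin n → Equiv.Perm Bool

/-- The trivial permaut. -/
def Permaut.id (n : ℕ) : Permaut n := ⟨1, fun _ => 1⟩

/-- `X^φ`: column `i` of `X` is transformed by `ψ i` and moved to position `π i`. -/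
def applyPermaut {m n : ℕ} (X : Matrix (Fin m) (Fin n) Bool) (φ : Permaut n) :
    Matrix (Fin m) (Fin n) Bool :=
  fun k j => φ.ψ (φ.π.symm j) (X k (φ.π.symm j))

/-- `X_σ`: row `k` of `X` is moved to position `σ k`. -/
def applyRowPerm {m n : ℕ} (X : Matrix (Fin m) (Fin n) Bool) (σ : Equiv.Perm (Fin m)) :
    Matrix (Fin m) (Fin n) Bool :=
  fun k j => X (σ.symm k) j

/-- `(σ, φ)` is a symmetry of the binary matrix `X`: `X_σ = X^φ`. -/
def IsSymmetry {m n : ℕ} (X : Matrix (Fin m) (Fin n) Bool) (σ : Equiv.Perm (Fin m))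
    (φ : Permaut n) : Prop :=
  applyRowPerm X σ = applyPermaut X φ

/-- A binary matrix is asymmetric when its only symmetry is the trivial one. -/
def IsAsymmetric {m n : ℕ} (X : Matrix (Fin m) (Fin n) Bool) : Prop :=
  ∀ (σ : Equiv.Perm (Fin m)) (φ : Permaut n), IsSymmetry X σ φ → σ = 1 ∧ φ = Permaut.id n

/-- `ν_m`: the fewest number of columns of an asymmetric binary matrix with `m` rows. -/
noncomputable def nu (m : ℕ) : ℕ :=
  sInf {n : ℕ | ∃ X : Matrix (Fin m) (Fin n) Bool, IsAsymmetric X}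

/-- `m` lies in the integer interval `[2^(n-1) - ρ(Q_(n-1)) + 1, 2^n - ρ(Q_n)]`. -/
def InInterval (m n : ℕ) : Prop :=
  (2 : ℤ) ^ (n - 1) - (cost (Q (n - 1)) : ℤ) + 1 ≤ (m : ℤ) ∧
    (m : ℤ) ≤ (2 : ℤ) ^ n - (cost (Q n) : ℤ)

end Hypercube

namespace Hypercube

/-! Automorphisms of `Q n` are exactly permauts, so an asymmetric `k` by `n` matrix is the same
thing as a distinguishing class of size `k`, listed row by row. Hence `cost (Q n)` is the least row
count of an asymmetric matrix with `n` columns. Complementing the class gives the symmetry `k ↦ 2 ^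
n - k`, so every asymmetric size lies between the cost and `2 ^ n - cost`.

The main point is that for `n ≥ 5` nothing in between is missed (`hasAsymmetric_of_cost_le`). By
complementation only `k ≤ 2 ^ (n - 1)` matters. For `k > n`, spread sets, whose column weights are
pairwise distinct, together with small explicit matrices, suffice (`hasAsymmetric_of_lt`). For `cost
< k ≤ n`, the bound `n ≤ 2 ^ (k - 1)`, applied to the cost, leaves room for a rigid path of columns
padded by others (`hasAsymmetric_of_cost_lt`).

Since the cost is at most half of `2 ^ n`, the bounds `2 ^ n - cost` do not decrease, so the
intervals tile the integers from 12 on. The starting point comes from the absence of asymmetric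
matrices with three or four rows: the cost of `Q 4` is at least 5, and three columns are too few for
`m ≥ 5`. -/

/-- There is an asymmetric binary matrix with `k` rows and `n` columns. -/
def HasAsymmetric (k n : ℕ) : Prop := ∃ X : Matrix (Fin k) (Fin n) Bool, IsAsymmetric X

/-! ### Automorphisms of the hypercube -/

/-- The action of a permaut on binary strings. -/
def Permaut.act {n : ℕ} (φ : Permaut n) (v : Fin n → Bool) : Fin n → Bool :=
  fun j => φ.ψ (φ.π.symm j) (v (φ.π.symm j))

theorem Permaut.act_apply {n : ℕ} (φ : Permaut n) (v : Fin n → Bool) (i : Fin n) :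
    φ.act v (φ.π i) = φ.ψ i (v i) := by
  simp [Permaut.act]

theorem Permaut.act_injective {n : ℕ} (φ : Permaut n) : Function.Injective φ.act := by
  intro v w h
  funext i
  have := congrFun h (φ.π i)
  rw [φ.act_apply, φ.act_apply] at this
  exact (φ.ψ i).injective this

theorem Permaut.act_surjective {n : ℕ} (φ : Permaut n) : Function.Surjective φ.act :=
  Finite.injective_iff_surjective.mp φ.act_injective

theorem Permaut.eq_id_of_act {n : ℕ} (φ : Permaut n) (h : ∀ v, φ.act v = v) :
    φ = Permaut.id n := by
  have hψ : ∀ i, φ.ψ i = 1 := by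
    intro i
    ext b
    have := φ.act_apply (fun _ => b) i
    rw [h] at this
    simpa using this.symm
  have hπ : φ.π = 1 := by
    ext1 i
    by_contra hi
    have := φ.act_apply (fun j => decide (j = i)) i
    rw [h, hψ] at this
    simp at this
    exact hi this
  cases φ
  simp only [Permaut.id, Permaut.mk.injEq]
  exact ⟨hπ, funext hψ⟩

theorem Permaut.act_adj_iff {n : ℕ} (φ : Permaut n) (v w : Fin n → Bool) :
    (Q n).Adj (φ.act v) (φ.act w) ↔ (Q n).Adj v w := by
  have key : ∀ i, φ.act v (φ.π i) ≠ φ.act w (φ.π i) ↔ v i ≠ w i := by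
    intro i
    rw [φ.act_apply, φ.act_apply, (φ.ψ i).injective.ne_iff]
  constructor
  · rintro ⟨j, hj, hu⟩
    obtain ⟨i, rfl⟩ := φ.π.surjective j
    exact ⟨i, (key i).mp hj, fun l hl => φ.π.injective (hu _ ((key l).mpr hl))⟩
  · rintro ⟨i, hi, hu⟩
    refine ⟨φ.π i, (key i).mpr hi, fun j hj => ?_⟩
    obtain ⟨l, rfl⟩ := φ.π.surjective j
    rw [hu l ((key l).mp hj)]

/-- The automorphism of the hypercube given by a permaut. -/
noncomputable def Permaut.toIso {n : ℕ} (φ : Permaut n) : Q n ≃g Q n where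
  toEquiv := Equiv.ofBijective φ.act ⟨φ.act_injective, φ.act_surjective⟩
  map_rel_iff' := φ.act_adj_iff _ _

@[simp] theorem Permaut.toIso_apply {n : ℕ} (φ : Permaut n) (v : Fin n → Bool) :
    φ.toIso v = φ.act v := rfl

theorem Permaut.toIso_symm_act {n : ℕ} (φ : Permaut n) (v : Fin n → Bool) :
    φ.toIso.symm (φ.act v) = v := φ.toIso.symm_apply_apply v

theorem adj_iff_update {n : ℕ} {v w : Fin n → Bool} :
    (Q n).Adj v w ↔ ∃ i, w = Function.update v i (!v i) := by
  constructor
  · rintro ⟨i, hi, hu⟩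
    refine ⟨i, funext fun j => ?_⟩
    by_cases hj : j = i
    · subst hj
      simp only [Function.update_self]
      revert hi
      cases v j <;> cases w j <;> simp
    · rw [Function.update_of_ne hj]
      by_contra h
      exact hj (hu j (Ne.symm h))
  · rintro ⟨i, rfl⟩
    refine ⟨i, by simp, fun j hj => ?_⟩
    by_contra h
    simp [Function.update_of_ne h] at hj

/-- The number of ones of a binary string. -/
def weight {k : ℕ} (c : Fin k → Bool) : ℕ := (Finset.univ.filter fun r => c r = true).card

/-- An automorphism of the hypercube that fixes the strings of weight at most one is trivial. -/
theorem iso_trivial_of_fix {n : ℕ} (F : Q n ≃g Q n) (h0 : F (fun _ => false) = fun _ => false)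
    (h1 : ∀ i, F (Function.update (fun _ => false) i true)
      = Function.update (fun _ => false) i true) (v : Fin n → Bool) : F v = v := by
  induction hw : weight v using Nat.strong_induction_on generalizing v with
  | _ w ih =>
  have drop : ∀ (u : Fin n → Bool) i, u i = true →
      weight (Function.update u i false) < weight u := by
    intro u i hi
    apply Finset.card_lt_card
    rw [Finset.ssubset_iff_of_subset]
    · exact ⟨i, by simp [hi], by simp⟩
    · intro j hj
      by_cases hji : j = i
      · subst hji; simp at hj
      · simpa [Function.update_of_ne hji] using hj
  by_cases hz : ∃ i, v i = true
  swap
  · have : v = fun _ => false := by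
      funext i
      simpa using fun h => hz ⟨i, h⟩
    rw [this, h0]
  obtain ⟨i, hi⟩ := hz
  by_cases hz : ∃ j, j ≠ i ∧ v j = true
  swap
  · have : v = Function.update (fun _ => false) i true := by
      funext j
      by_cases hji : j = i
      · subst hji; simpa using hi
      · rw [Function.update_of_ne hji]
        simpa using fun h => hz ⟨j, hji, h⟩
    rw [this, h1]
  obtain ⟨j, hji, hj⟩ := hz
  -- The two neighbours of `v` obtained by deleting a one are fixed, so `F v` is a common neighbour
  -- of them: either `v`, or `v` with both ones deleted. The latter is itself fixed, so injectivity
  -- excludes it.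
  have e1 := ih _ (hw ▸ drop v i hi) _ rfl
  have e2 := ih _ (hw ▸ drop v j hj) _ rfl
  have hij' : Function.update v i false j = true := by rw [Function.update_of_ne hji, hj]
  have e3 := ih _ (hw ▸ (drop _ j hij').trans (drop v i hi)) _ rfl
  have a1 : (Q n).Adj v (Function.update v i false) :=
    adj_iff_update.mpr ⟨i, by simp [hi]⟩
  have a2 : (Q n).Adj v (Function.update v j false) :=
    adj_iff_update.mpr ⟨j, by simp [hj]⟩
  have b1 := F.map_rel_iff.mpr a1
  have b2 := F.map_rel_iff.mpr a2
  rw [e1] at b1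
  rw [e2] at b2
  obtain ⟨p, hp⟩ := adj_iff_update.mp b1.symm
  obtain ⟨q, hq⟩ := adj_iff_update.mp b2.symm
  by_cases hpi : p = i
  · subst hpi
    rw [hp]
    simp
    exact hi
  · exfalso
    have hFi : F v i = false := by
      rw [hp, Function.update_of_ne (Ne.symm hpi)]; simp
    have hqi : q = i := by
      by_contra hqi
      rw [hq, Function.update_of_ne (Ne.symm hqi), Function.update_of_ne (Ne.symm hji), hi] at hFi
      exact absurd hFi (by simp)
    have hF : F v = Function.update (Function.update v i false) j false := by
      rw [hq, hqi]
      funext l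
      by_cases hl : l = i
      · subst hl
        rw [Function.update_self, Function.update_of_ne (Ne.symm hji),
          Function.update_of_ne (Ne.symm hji), hi]
        simp
      · rw [Function.update_of_ne hl]
        by_cases hlj : l = j
        · subst hlj; simp
        · rw [Function.update_of_ne hlj, Function.update_of_ne hlj, Function.update_of_ne hl]
    have := F.injective (hF.trans e3.symm)
    have := congrFun this j
    simp [hj] at this

/-- Every automorphism of the hypercube comes from a permaut. -/
theorem exists_permaut {n : ℕ} (F : Q n ≃g Q n) : ∃ φ : Permaut n, ∀ v, F v = φ.act v := by
  set o : Fin n → Bool := fun _ => false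
  have key : ∀ i, ∃ j, F (Function.update o i true) = Function.update (F o) j (!F o j) := by
    intro i
    apply adj_iff_update.mp
    apply F.map_rel_iff.mpr
    exact adj_iff_update.mpr ⟨i, by simp [o]⟩
  choose f hf using key
  have hinj : Function.Injective f := by
    intro i i' h
    have : F (Function.update o i true) = F (Function.update o i' true) := by rw [hf, hf, h]
    have := congrFun (F.injective this) i
    by_contra hne
    simp [Function.update_of_ne hne, o] at this
  let π : Equiv.Perm (Fin n) := Equiv.ofBijective f (Finite.injective_iff_bijective.mp hinj)
  have hπ : ∀ i, π i = f i := fun i => rfl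
  -- `φ` is built to agree with `F` on the zero string and its neighbours, so `F` followed by `φ⁻¹`
  -- falls under `iso_trivial_of_fix`.
  let φ : Permaut n := ⟨π, fun i => if F o (f i) then Equiv.swap false true else 1⟩
  have hφ : ∀ v i, φ.act v (f i) = xor (v i) (F o (f i)) := by
    intro v i
    rw [← hπ, show π i = φ.π i from rfl, φ.act_apply]
    simp only [φ, hπ]
    cases F o (f i) <;> cases v i <;> simp
  have hsurj : ∀ j, ∃ i, f i = j := fun j => ⟨π.symm j, by rw [← hπ]; simp⟩
  have hφo : φ.act o = F o := by
    funext j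
    obtain ⟨i, rfl⟩ := hsurj j
    rw [hφ]; simp [o]
  have hφi : ∀ i, φ.act (Function.update o i true) = F (Function.update o i true) := by
    intro i
    funext j
    obtain ⟨l, rfl⟩ := hsurj j
    rw [hφ, hf]
    by_cases h : l = i
    · subst h; simp
    · rw [Function.update_of_ne h, Function.update_of_ne (fun e => h (hinj e))]
      simp [o]
  let G : Q n ≃g Q n := F.trans φ.toIso.symm
  have hG : ∀ v, G v = v := by
    apply iso_trivial_of_fix
    · change φ.toIso.symm (F o) = o
      rw [← hφo, Permaut.toIso_symm_act]
    · intro i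
      change φ.toIso.symm (F (Function.update o i true)) = _
      rw [← hφi, Permaut.toIso_symm_act]
  refine ⟨φ, fun v => ?_⟩
  have : φ.toIso.symm (F v) = v := hG v
  rw [← Permaut.toIso_apply]
  exact (φ.toIso.apply_symm_apply (F v)).symm.trans (by rw [this])

/-! ### Distinguishing classes as asymmetric matrices -/

theorem isDistinguishingClass_iff {n : ℕ} (S : Set (Fin n → Bool)) :
    IsDistinguishingClass (Q n) S ↔
      ∀ φ : Permaut n, (∀ v, φ.act v ∈ S ↔ v ∈ S) → φ = Permaut.id n := by
  classical
  constructor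
  · rintro ⟨c, hc, i, rfl⟩ φ hφ
    apply φ.eq_id_of_act
    intro v
    refine hc φ.toIso (fun v => ?_) v
    have := hφ v
    change c (φ.act v) = i ↔ c v = i at this
    rw [Permaut.toIso_apply]
    omega
  · intro h
    refine ⟨fun v => if v ∈ S then 0 else 1, fun F hF => ?_, 0, ?_⟩
    · obtain ⟨φ, hφ⟩ := exists_permaut F
      have := h φ fun v => by
        have := hF v
        rw [hφ] at this
        by_cases h1 : φ.act v ∈ S <;> by_cases h2 : v ∈ S <;> simp_all
      intro v
      rw [hφ, this]
      rfl
    · ext v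
      simp

theorem isSymmetry_iff {k n : ℕ} (X : Matrix (Fin k) (Fin n) Bool) (σ : Equiv.Perm (Fin k))
    (φ : Permaut n) : IsSymmetry X σ φ ↔ ∀ r, X (σ.symm r) = φ.act (X r) :=
  ⟨fun h r => congrFun h r, fun h => funext h⟩

theorem IsAsymmetric.rows_injective {k n : ℕ} {X : Matrix (Fin k) (Fin n) Bool}
    (hX : IsAsymmetric X) : Function.Injective X := by
  intro r s h
  have := (hX (Equiv.swap r s) (Permaut.id n) ((isSymmetry_iff _ _ _).mpr fun t => ?_)).1
  · exact (Equiv.swap_eq_one_iff).mp this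
  · change X _ = X t
    rw [Equiv.symm_swap, Equiv.swap_apply_def]
    split_ifs with h1 h2
    · rw [h1, h]
    · rw [h2, h]
    · rfl

/-- The rows of an asymmetric matrix are distinct, as two equal rows could be swapped. With distinct
rows the row permutation is determined by the permaut, so only the set of rows matters. -/
theorem exists_distinguishingClass_iff (k n : ℕ) :
    (∃ S : Set (Fin n → Bool), IsDistinguishingClass (Q n) S ∧ S.ncard = k) ↔
      HasAsymmetric k n := by
  simp only [isDistinguishingClass_iff]
  constructor
  · rintro ⟨S, hS, hk⟩
    have e : Fin k ≃ S := by
      rw [← Nat.card_coe_set_eq] at hk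
      exact (Finite.equivFinOfCardEq hk).symm
    refine ⟨fun r => (e r : Fin n → Bool), fun σ φ h => ?_⟩
    replace h := (isSymmetry_iff _ _ _).mp h
    have hφ : φ = Permaut.id n := by
      apply hS
      have hmaps : ∀ v ∈ S, φ.act v ∈ S := by
        intro v hv
        have := h (e.symm ⟨v, hv⟩)
        simp only [Equiv.apply_symm_apply] at this
        rw [← this]
        exact Subtype.coe_prop _
      intro v
      refine ⟨fun hv => ?_, hmaps v⟩
      obtain ⟨w, hw, hwv⟩ : φ.act v ∈ φ.act '' S := by
        rwa [Set.eq_of_subset_of_ncard_le (Set.image_subset_iff.mpr hmaps)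
          (Set.ncard_image_of_injective S φ.act_injective).ge (Set.toFinite S)]
      rwa [← φ.act_injective hwv]
    refine ⟨?_, hφ⟩
    subst hφ
    ext1 r
    have := h (σ r)
    rw [Equiv.symm_apply_apply] at this
    exact (e.injective (Subtype.ext this)).symm
  · rintro ⟨X, hX⟩
    refine ⟨Set.range X, fun φ hφ => ?_, ?_⟩
    · have : ∀ r, ∃ s, X s = φ.act (X r) := fun r => (hφ (X r)).mpr ⟨r, rfl⟩
      choose f hf using this
      have hinj : Function.Injective f := fun r s h =>
        hX.rows_injective (φ.act_injective (by rw [← hf, ← hf, h]))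
      refine (hX (Equiv.ofBijective f (Finite.injective_iff_bijective.mp hinj)).symm φ
        ((isSymmetry_iff _ _ _).mpr fun r => ?_)).2
      exact hf r
    · have h : (Set.range fun r => X r).ncard = (Set.univ : Set (Fin k)).ncard := by
        rw [← Set.image_univ]
        exact Set.ncard_image_of_injective _ hX.rows_injective
      simpa using h

theorem cost_Q (n : ℕ) : cost (Q n) = sInf {k | HasAsymmetric k n} := by
  simp only [cost, exists_distinguishingClass_iff]

/-! ### Complementation and bounds on the number of columns -/

theorem HasAsymmetric.le_two_pow {k n : ℕ} (h : HasAsymmetric k n) : k ≤ 2 ^ n := by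
  obtain ⟨X, hX⟩ := h
  simpa using Fintype.card_le_of_injective _ hX.rows_injective

theorem HasAsymmetric.compl {k n : ℕ} (h : HasAsymmetric k n) : HasAsymmetric (2 ^ n - k) n := by
  rw [← exists_distinguishingClass_iff] at h ⊢
  obtain ⟨S, hS, hk⟩ := h
  refine ⟨Sᶜ, ?_, ?_⟩
  · rw [isDistinguishingClass_iff] at hS ⊢
    exact fun φ hφ => hS φ fun v => not_iff_not.mp (hφ v)
  · rw [Set.ncard_compl, hk]
    simp

/-- Otherwise swapping the two columns, and complementing both when `b` is true, would fix every
row. -/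
theorem IsAsymmetric.columns_distinct {k n : ℕ} {X : Matrix (Fin k) (Fin n) Bool}
    (hX : IsAsymmetric X) {i j : Fin n} {b : Bool} (h : ∀ r, X r i = xor b (X r j)) : i = j := by
  by_contra hij
  let φ : Permaut n := ⟨Equiv.swap i j, fun l =>
    if (l = i ∨ l = j) ∧ b = true then Equiv.swap false true else 1⟩
  have hφ : IsSymmetry X 1 φ := by
    rw [isSymmetry_iff]
    intro r
    funext l
    change X r l = φ.ψ ((Equiv.swap i j).symm l) (X r ((Equiv.swap i j).symm l))
    have hr := h r
    rw [Equiv.symm_swap, Equiv.swap_apply_def]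
    split_ifs with h1 h2
    · subst h1
      cases b <;> cases hj : X r j <;> simp_all [φ]
    · subst h2
      cases b <;> cases hj : X r l <;> simp_all [φ]
    · simp [φ, h1, h2]
  have := congrArg Permaut.π (hX 1 φ hφ).2
  exact hij (Equiv.swap_eq_one_iff.mp this)

/-- The columns and their complements are `2 * n` different vectors; a row must exist to tell a
column from its own complement. -/
theorem HasAsymmetric.two_mul_le {k n : ℕ} (h : HasAsymmetric (k + 1) n) :
    2 * n ≤ 2 ^ (k + 1) := by
  obtain ⟨X, hX⟩ := h
  have : Function.Injective fun p : Bool × Fin n => fun r => xor p.1 (X r p.2) := by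
    rintro ⟨b, i⟩ ⟨c, j⟩ hbc
    have hbc : ∀ r, xor b (X r i) = xor c (X r j) := fun r => congrFun hbc r
    have hij : i = j := hX.columns_distinct (b := xor b c) fun r => by
      have := hbc r
      revert this
      cases b <;> cases c <;> cases X r i <;> cases X r j <;> simp
    subst hij
    have := hbc 0
    simpa using this
  simpa using Fintype.card_le_of_injective _ this

theorem HasAsymmetric.le_two_pow_pred {k n : ℕ} (h : HasAsymmetric k n) : n ≤ 2 ^ (k - 1) := by
  cases k with
  | zero =>
    obtain ⟨X, hX⟩ := h
    have : Subsingleton (Fin n) := ⟨fun i j => hX.columns_distinct (b := false) fun r => r.elim0⟩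
    simpa using Fintype.card_le_one_iff_subsingleton.mpr this
  | succ k =>
    have := h.two_mul_le
    rw [pow_succ] at this
    simp only [Nat.add_sub_cancel]
    omega

/-! ### No asymmetric matrices with three or four rows -/

/-- A row permutation that maps every column to a column, up to complementation, extends to a
symmetry. -/
theorem IsAsymmetric.eq_one_of_maps_columns {k n : ℕ} {X : Matrix (Fin k) (Fin n) Bool}
    (hX : IsAsymmetric X) (σ : Equiv.Perm (Fin k))
    (h : ∀ j, ∃ l b, ∀ r, X (σ r) l = xor b (X r j)) : σ = 1 := by
  choose f b hf using h
  have hinj : Function.Injective f := by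
    intro i j hij
    refine hX.columns_distinct (b := xor (b i) (b j)) fun r => ?_
    have h1 := hf i r
    rw [hij, hf j r] at h1
    revert h1
    cases b i <;> cases b j <;> cases X r i <;> cases X r j <;> simp
  let φ : Permaut n := ⟨Equiv.ofBijective f (Finite.injective_iff_bijective.mp hinj),
    fun i => if b i then Equiv.swap false true else 1⟩
  have := (hX σ⁻¹ φ ((isSymmetry_iff _ _ _).mpr fun r => ?_)).1
  · simpa using this
  · funext l
    obtain ⟨j, rfl⟩ := φ.π.surjective l
    rw [φ.act_apply]
    change X (σ r) (f j) = _
    rw [hf]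
    cases hb : b j <;> cases X r j <;> simp [φ, hb]

/-- `c` is a column of `X`, up to complementation. -/
def IsColumn {k n : ℕ} (X : Matrix (Fin k) (Fin n) Bool) (c : Fin k → Bool) : Prop :=
  ∃ j b, ∀ r, X r j = xor b (c r)

theorem isColumn_not {k n : ℕ} {X : Matrix (Fin k) (Fin n) Bool} {c : Fin k → Bool} :
    IsColumn X (fun r => !c r) ↔ IsColumn X c := by
  constructor
  · rintro ⟨j, b, h⟩
    exact ⟨j, !b, fun r => by rw [h]; simp⟩
  · rintro ⟨j, b, h⟩
    exact ⟨j, !b, fun r => by rw [h]; simp⟩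

theorem IsAsymmetric.eq_one_of_isColumn {k n : ℕ} {X : Matrix (Fin k) (Fin n) Bool}
    (hX : IsAsymmetric X) (σ : Equiv.Perm (Fin k))
    (h : ∀ c, IsColumn X c → IsColumn X (c ∘ σ)) : σ = 1 := by
  rw [← inv_eq_one]
  apply hX.eq_one_of_maps_columns
  intro j
  obtain ⟨l, b, hl⟩ := h (fun r => X r j) ⟨j, false, fun r => by simp⟩
  exact ⟨l, b, fun r => by rw [hl]; simp⟩

theorem IsAsymmetric.eq_one_of_isColumn_generators {k n : ℕ} {X : Matrix (Fin k) (Fin n) Bool}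
    (hX : IsAsymmetric X) (σ : Equiv.Perm (Fin k)) (G : Set (Fin k → Bool))
    (hG : ∀ c, c ∈ G ∨ (fun r => !c r) ∈ G)
    (h : ∀ c ∈ G, IsColumn X c → IsColumn X (c ∘ σ)) : σ = 1 := by
  refine hX.eq_one_of_isColumn σ fun c hc => ?_
  rcases hG c with hcG | hcG
  · exact h c hcG hc
  · exact isColumn_not.mp (h _ hcG (isColumn_not.mpr hc))

/-- Up to complement, a nonconstant column singles out one row. Two of the three rows agree on
whether their singleton column occurs, and these can be swapped. -/
theorem not_hasAsymmetric_three (n : ℕ) : ¬ HasAsymmetric 3 n := by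
  rintro ⟨X, hX⟩
  set s : Fin 3 → Prop := fun a => IsColumn X fun r => decide (r = a) with hs
  have key : ∀ a b : Fin 3, a ≠ b → (s a ↔ s b) → False := by
    intro a b hab hab'
    refine hab (Equiv.swap_eq_one_iff.mp (hX.eq_one_of_isColumn_generators (Equiv.swap a b)
      ({fun _ => false} ∪ Set.range fun a r => decide (r = a)) ?_ ?_))
    · have : ∀ c : Fin 3 → Bool, (c = (fun _ => false) ∨ ∃ a, (fun r => decide (r = a)) = c) ∨
          ((fun r => !c r) = (fun _ => false) ∨ ∃ a, (fun r => decide (r = a)) = fun r => !c r) := by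
        decide
      exact this
    · rintro c (rfl | ⟨d, rfl⟩) hc
      · exact hc
      · have : (fun r => decide (r = d)) ∘ Equiv.swap a b
            = fun r => decide (r = Equiv.swap a b d) := by
          funext r
          simp [Equiv.swap_apply_eq_iff]
        rw [this]
        change s (Equiv.swap a b d)
        change s d at hc
        rw [Equiv.swap_apply_def]
        split_ifs with h1 h2
        · rw [h1] at hc; exact hab'.mp hc
        · rw [h2] at hc; exact hab'.mpr hc
        · exact hc
  have h01 := key 0 1 (by decide)
  have h02 := key 0 2 (by decide)
  have h12 := key 1 2 (by decide)
  tauto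

/-- Here `s` records the singleton columns and `t` the three splittings into pairs. If `s` splits
the rows two and two, a double transposition works, since it fixes all splittings. Otherwise three
rows agree; their transpositions induce all three transpositions of the splittings, two of which
agree under `t`. -/
theorem exists_symmetry_pattern_four (s0 s1 s2 s3 t1 t2 t3 : Prop) :
    ((s0 ↔ s1) ∧ (t2 ↔ t3)) ∨
    ((s0 ↔ s2) ∧ (t1 ↔ t3)) ∨
    ((s0 ↔ s3) ∧ (t1 ↔ t2)) ∨
    ((s1 ↔ s2) ∧ (t1 ↔ t2)) ∨
    ((s1 ↔ s3) ∧ (t1 ↔ t3)) ∨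
    ((s2 ↔ s3) ∧ (t2 ↔ t3)) ∨
    ((s0 ↔ s1) ∧ (s2 ↔ s3)) ∨
    ((s0 ↔ s2) ∧ (s1 ↔ s3)) ∨
    ((s0 ↔ s3) ∧ (s1 ↔ s2)) := by
  grind

theorem not_hasAsymmetric_four (n : ℕ) : ¬ HasAsymmetric 4 n := by
  rintro ⟨X, hX⟩
  set s : Fin 4 → Prop := fun a => IsColumn X fun r => decide (r = a) with hs
  set t : Fin 4 → Fin 4 → Prop := fun a b => IsColumn X fun r => decide (r = a ∨ r = b) with ht
  have key : ∀ σ : Equiv.Perm (Fin 4), σ ≠ 1 → ∀ p₀ p₁ p₂ p₃, σ 0 = p₀ → σ 1 = p₁ → σ 2 = p₂ →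
      σ 3 = p₃ → (s 0 → s p₀) → (s 1 → s p₁) → (s 2 → s p₂) → (s 3 → s p₃) →
      (t 0 1 → t p₀ p₁) → (t 0 2 → t p₀ p₂) → (t 0 3 → t p₀ p₃) → False := by
    rintro σ hσ _ _ _ _ rfl rfl rfl rfl h0 h1 h2 h3 h01 h02 h03
    rw [← inv_ne_one] at hσ
    refine hσ (hX.eq_one_of_isColumn_generators σ⁻¹
      ({fun _ => false} ∪ (Set.range fun a r => decide (r = a)) ∪
        Set.range fun a r => decide (r = 0 ∨ r = a)) ?_ ?_)
    · have : ∀ c : Fin 4 → Bool, ((c = (fun _ => false) ∨ ∃ a, (fun r => decide (r = a)) = c) ∨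
          (∃ a, (fun r => decide (r = 0 ∨ r = a)) = c)) ∨
          (((fun r => !c r) = (fun _ => false) ∨ ∃ a, (fun r => decide (r = a)) = fun r => !c r) ∨
          (∃ a, (fun r => decide (r = 0 ∨ r = a)) = fun r => !c r)) := by
        decide
      exact this
    · have es : ∀ a, (fun r => decide (r = a)) ∘ (σ⁻¹ : Equiv.Perm (Fin 4)) = fun r => decide (r = σ a) := by
        intro a; funext r
        simp [Equiv.symm_apply_eq]
      have et : ∀ a, (fun r => decide (r = 0 ∨ r = a)) ∘ (σ⁻¹ : Equiv.Perm (Fin 4))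
          = fun r => decide (r = σ 0 ∨ r = σ a) := by
        intro a; funext r
        simp [Equiv.symm_apply_eq]
      have hs' : ∀ a, s a → s (σ a) := by
        intro a; fin_cases a <;> assumption
      have ht' : ∀ a, t 0 a → t (σ 0) (σ a) := by
        intro a; fin_cases a
        · simpa [ht] using h0
        all_goals assumption
      rintro c ((rfl | ⟨d, rfl⟩) | ⟨d, rfl⟩) hc
      · exact hc
      · rw [es]; exact hs' d hc
      · rw [et]; exact ht' d hc
  -- A pair of rows is replaced, by complementing if needed, by the pair of the same splitting that
  -- contains row 0.
  have norm : ∀ a b x : Fin 4,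
      ((fun r : Fin 4 => decide (r = a ∨ r = b)) = (fun r => decide (r = 0 ∨ r = x)) ∨
        (fun r : Fin 4 => decide (r = a ∨ r = b)) = fun r => !decide (r = 0 ∨ r = x)) →
      t 0 x → t a b := by
    rintro a b x (h | h) hx
    · simp only [ht, h]; exact hx
    · simp only [ht, h]; exact isColumn_not.mpr hx
  rcases exists_symmetry_pattern_four (s 0) (s 1) (s 2) (s 3) (t 0 1) (t 0 2) (t 0 3) with
    ⟨h0, h1⟩ |
    ⟨h0, h1⟩ |
    ⟨h0, h1⟩ |
    ⟨h0, h1⟩ |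
    ⟨h0, h1⟩ |
    ⟨h0, h1⟩ |
    ⟨h0, h1⟩ |
    ⟨h0, h1⟩ |
    ⟨h0, h1⟩
  · exact key (Equiv.swap 0 1) (by decide) 1 0 2 3 (by decide) (by decide) (by decide)
      (by decide) h0.mp h0.mpr id id
      (fun h => norm 1 0 1 (by decide) (h))
      (fun h => norm 1 2 3 (by decide) (h1.mp h))
      (fun h => norm 1 3 2 (by decide) (h1.mpr h))
  · exact key (Equiv.swap 0 2) (by decide) 2 1 0 3 (by decide) (by decide) (by decide)
      (by decide) h0.mp id h0.mpr id
      (fun h => norm 2 1 3 (by decide) (h1.mp h))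
      (fun h => norm 2 0 2 (by decide) (h))
      (fun h => norm 2 3 1 (by decide) (h1.mpr h))
  · exact key (Equiv.swap 0 3) (by decide) 3 1 2 0 (by decide) (by decide) (by decide)
      (by decide) h0.mp id id h0.mpr
      (fun h => norm 3 1 2 (by decide) (h1.mp h))
      (fun h => norm 3 2 1 (by decide) (h1.mpr h))
      (fun h => norm 3 0 3 (by decide) (h))
  · exact key (Equiv.swap 1 2) (by decide) 0 2 1 3 (by decide) (by decide) (by decide)
      (by decide) id h0.mp h0.mpr id
      (fun h => norm 0 2 2 (by decide) (h1.mp h))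
      (fun h => norm 0 1 1 (by decide) (h1.mpr h))
      (fun h => norm 0 3 3 (by decide) (h))
  · exact key (Equiv.swap 1 3) (by decide) 0 3 2 1 (by decide) (by decide) (by decide)
      (by decide) id h0.mp id h0.mpr
      (fun h => norm 0 3 3 (by decide) (h1.mp h))
      (fun h => norm 0 2 2 (by decide) (h))
      (fun h => norm 0 1 1 (by decide) (h1.mpr h))
  · exact key (Equiv.swap 2 3) (by decide) 0 1 3 2 (by decide) (by decide) (by decide)
      (by decide) id id h0.mp h0.mpr
      (fun h => norm 0 1 1 (by decide) (h))
      (fun h => norm 0 3 3 (by decide) (h1.mp h))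
      (fun h => norm 0 2 2 (by decide) (h1.mpr h))
  · exact key (Equiv.swap 0 1 * Equiv.swap 2 3) (by decide) 1 0 3 2 (by decide) (by decide) (by decide)
      (by decide) h0.mp h0.mpr h1.mp h1.mpr
      (fun h => norm 1 0 1 (by decide) (h))
      (fun h => norm 1 3 2 (by decide) (h))
      (fun h => norm 1 2 3 (by decide) (h))
  · exact key (Equiv.swap 0 2 * Equiv.swap 1 3) (by decide) 2 3 0 1 (by decide) (by decide) (by decide)
      (by decide) h0.mp h1.mp h0.mpr h1.mpr
      (fun h => norm 2 3 1 (by decide) (h))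
      (fun h => norm 2 0 2 (by decide) (h))
      (fun h => norm 2 1 3 (by decide) (h))
  · exact key (Equiv.swap 0 3 * Equiv.swap 1 2) (by decide) 3 2 1 0 (by decide) (by decide) (by decide)
      (by decide) h0.mp h1.mp h1.mpr h0.mpr
      (fun h => norm 3 2 1 (by decide) (h))
      (fun h => norm 3 1 2 (by decide) (h))
      (fun h => norm 3 0 3 (by decide) (h))

/-! ### Asymmetric matrices from a path of columns -/

/-- A family of columns, pairwise distinct up to complementation, which is preserved by no
nontrivial row permutation gives an asymmetric matrix. -/
theorem hasAsymmetric_of_columns {k : ℕ} (C : Finset (Fin (k + 1) → Bool))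
    (hC : ∀ c ∈ C, (fun r => !c r) ∉ C)
    (h : ∀ σ : Equiv.Perm (Fin (k + 1)),
      (∀ c ∈ C, c ∘ σ ∈ C ∨ (fun r => !c (σ r)) ∈ C) → σ = 1) :
    HasAsymmetric (k + 1) C.card := by
  let e := C.equivFin.symm
  refine ⟨fun r j => (e j : Fin (k + 1) → Bool) r, fun σ φ hs => ?_⟩
  replace hs := (isSymmetry_iff _ _ _).mp hs
  have hs' : ∀ r j, (e (φ.π j) : Fin (k + 1) → Bool) (σ.symm r)
      = φ.ψ j ((e j : Fin (k + 1) → Bool) r) := by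
    intro r j
    have := φ.act_apply (fun j => (e j : Fin (k + 1) → Bool) r) j
    rw [← this, ← hs]
  have hψ : ∀ j, (∀ b, φ.ψ j b = b) ∨ (∀ b, φ.ψ j b = !b) := by
    intro j
    generalize φ.ψ j = p
    revert p; decide
  have hinj : ∀ i j, (e i : Fin (k + 1) → Bool) = e j → i = j := fun i j hij =>
    e.injective (Subtype.ext hij)
  have hσ : σ.symm = 1 := by
    apply h
    intro c hc
    obtain ⟨j, hj⟩ := e.surjective ⟨c, hc⟩
    obtain ⟨i, rfl⟩ := φ.π.surjective j
    have hcj : (e (φ.π i) : Fin (k + 1) → Bool) = c := by rw [hj]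
    rcases hψ i with hp | hp
    · left
      have : c ∘ σ.symm = e i := by
        funext r
        rw [Function.comp_apply, ← hcj, hs', hp]
      rw [this]
      exact (e i).2
    · right
      have : (fun r => !c (σ.symm r)) = e i := by
        funext r
        rw [← hcj, hs', hp, Bool.not_not]
      rw [this]
      exact (e i).2
  have hσ1 : σ = 1 := by
    rw [← Equiv.symm_symm σ, hσ]; rfl
  refine ⟨hσ1, φ.eq_id_of_act fun v => ?_⟩
  have hfix : ∀ j, φ.π j = j ∧ ∀ b, φ.ψ j b = b := by
    intro j
    rcases hψ j with hp | hp
    · refine ⟨hinj _ _ (funext fun r => ?_), hp⟩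
      have := hs' r j
      rw [hσ, hp] at this
      exact this
    · exfalso
      apply hC _ (e (φ.π j)).2
      have : (fun r => !(e (φ.π j) : Fin (k + 1) → Bool) r) = e j := by
        funext r
        have := hs' r j
        rw [hσ, hp] at this
        exact (congrArg (! ·) this).trans (Bool.not_not _)
      rw [this]
      exact (e j).2
  funext j
  have := φ.act_apply v j
  rw [(hfix j).1, (hfix j).2] at this
  exact this

theorem weight_comp {k : ℕ} (c : Fin k → Bool) (σ : Equiv.Perm (Fin k)) :
    weight (c ∘ σ) = weight c :=
  Finset.card_equiv σ (by simp)

theorem weight_not {k : ℕ} (c : Fin k → Bool) : weight (fun r => !c r) + weight c = k := by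
  have := Finset.card_filter_add_card_filter_not (s := (Finset.univ : Finset (Fin k)))
    (fun r => c r = true)
  simp only [Finset.card_univ, Fintype.card_fin, Bool.not_eq_true] at this
  simp only [weight, Bool.not_eq_true']
  omega

/-- The columns of a path: the `i`-th one marks the rows `i - 1` and `i`. -/
def pathColumn (k i : ℕ) : Fin k → Bool := fun r => decide ((r : ℕ) = i ∨ (r : ℕ) + 1 = i)

theorem weight_pathColumn {k i : ℕ} (hi : i < k) :
    weight (pathColumn k i) = if i = 0 then 1 else 2 := by
  rcases i with _ | i
  · have : (Finset.univ.filter fun r => pathColumn k 0 r = true) = {⟨0, hi⟩} := by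
      ext r
      simp [pathColumn, Fin.ext_iff]
    simp [weight, this]
  · have : (Finset.univ.filter fun r => pathColumn k (i + 1) r = true)
        = {⟨i, by omega⟩, ⟨i + 1, hi⟩} := by
      ext r
      simp only [pathColumn, Finset.mem_filter, Finset.mem_univ, true_and, decide_eq_true_eq,
        Finset.mem_insert, Finset.mem_singleton, Fin.ext_iff]
      omega
    rw [weight, this, Finset.card_pair (by simp [Fin.ext_iff])]
    simp

theorem pathColumn_injective {k i j : ℕ} (hi : i < k) (hj : j < k)
    (h : pathColumn k i = pathColumn k j) : i = j := by
  have h1 := congrFun h ⟨i, hi⟩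
  have h2 := congrFun h ⟨j, hj⟩
  simp [pathColumn] at h1 h2
  omega

/-- A row permutation that maps the columns of a path to columns of the path, keeping their
weights, is trivial. -/
theorem eq_one_of_maps_pathColumn {k : ℕ} (σ : Equiv.Perm (Fin k))
    (h : ∀ i, i + 1 < k → ∃ j, (j = 0 ↔ i = 0) ∧ pathColumn k i ∘ σ = pathColumn k j) :
    σ = 1 := by
  have key : ∀ i (hi : i + 1 < k), ∀ l (hl : l < k), l ≤ i → σ ⟨l, hl⟩ = ⟨l, hl⟩ := by
    intro i
    induction i with
    | zero =>
      intro hi l hl hl0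
      obtain ⟨j, hj, hc⟩ := h 0 hi
      rw [hj.mpr rfl] at hc
      have := congrFun hc ⟨l, hl⟩
      simp only [pathColumn, Function.comp_apply, decide_eq_decide] at this
      ext
      simp only
      omega
    | succ i ih =>
      intro hi l hl hli
      have ih := ih (by omega)
      rcases Nat.lt_or_ge l (i + 1) with hlt | hge
      · exact ih l hl (by omega)
      obtain rfl : l = i + 1 := by omega
      obtain ⟨j, hj, hc⟩ := h (i + 1) hi
      have e : ∀ r : Fin k, (((σ r : Fin k) : ℕ) = i + 1 ∨ ((σ r : Fin k) : ℕ) + 1 = i + 1) ↔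
          ((r : ℕ) = j ∨ (r : ℕ) + 1 = j) := fun r => by
        have := congrFun hc r
        simpa only [pathColumn, Function.comp_apply, decide_eq_decide] using this
      have e1 : (i = i + 1 ∨ i + 1 = i + 1) ↔ (i = j ∨ i + 1 = j) := by
        have := e ⟨i, by omega⟩
        rwa [ih i (by omega) le_rfl] at this
      -- Row `i` is fixed and marked, so `j` is `i` or `i + 1`. The value `i` is excluded by row `i
      -- - 1`, or by the weight condition when `i = 0`.
      have hjcase : j = i + 1 := by
        rcases Nat.eq_zero_or_pos i with h0 | h0
        · omega
        · have e2 : (i - 1 = i + 1 ∨ i - 1 + 1 = i + 1) ↔ (i - 1 = j ∨ i - 1 + 1 = j) := by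
            have := e ⟨i - 1, by omega⟩
            rwa [ih (i - 1) (by omega) (by omega)] at this
          omega
      have e3 : ((σ ⟨i + 1, hl⟩ : ℕ) = i + 1 ∨ (σ ⟨i + 1, hl⟩ : ℕ) + 1 = i + 1) ↔
          (i + 1 = j ∨ i + 1 + 1 = j) := e ⟨i + 1, hl⟩
      have e4 : (σ ⟨i + 1, hl⟩ : ℕ) ≠ i := by
        intro h4
        have h5 : σ ⟨i + 1, hl⟩ = σ ⟨i, by omega⟩ := by
          rw [ih i (by omega) le_rfl]
          exact Fin.ext h4
        have := congrArg Fin.val (σ.injective h5)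
        simp at this
      ext
      change (σ ⟨i + 1, hl⟩ : ℕ) = i + 1
      omega
  ext1 r
  rw [Equiv.Perm.one_apply]
  rcases Nat.lt_or_ge ((r : ℕ) + 1) k with hr | hr
  · exact key r hr r r.2 le_rfl
  · by_contra hne
    have hlt : ((σ r : Fin k) : ℕ) + 1 < k := by
      have := (σ r).2
      have := r.2
      have : (σ r : ℕ) ≠ r := fun h => hne (Fin.ext h)
      omega
    exact hne (σ.injective (key (σ r) hlt (σ r) (σ r).2 le_rfl))

/-- The columns that vanish in the first row and have more than two zeros and, unless they vanish,
more than two ones. -/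
def heavyColumns (k : ℕ) : Finset (Fin (k + 1) → Bool) :=
  Finset.univ.filter fun c => c 0 = false ∧
    weight c ≠ 1 ∧ weight c ≠ 2 ∧ weight c + 1 ≠ k + 1 ∧ weight c + 2 ≠ k + 1

theorem exists_sym2_of_weight {k : ℕ} (c : Fin k → Bool) (h : weight c = 1 ∨ weight c = 2) :
    ∃ z : Sym2 (Fin k), ∀ r, c r = decide (r ∈ z) := by
  have aux : ∀ z : Sym2 (Fin k), (∀ r, r ∈ (Finset.univ.filter fun r => c r = true) ↔ r ∈ z) →
      ∀ r, c r = decide (r ∈ z) := by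
    intro z hz r
    have := hz r
    simp only [Finset.mem_filter, Finset.mem_univ, true_and] at this
    rw [Bool.eq_iff_iff, this]
    simp
  rcases h with h | h
  · obtain ⟨a, ha⟩ := Finset.card_eq_one.mp h
    exact ⟨s(a, a), aux _ fun r => by rw [ha]; simp⟩
  · obtain ⟨a, b, -, ha⟩ := Finset.card_eq_two.mp h
    exact ⟨s(a, b), aux _ fun r => by rw [ha]; simp⟩

/-- A column vanishing in row 0 that is not heavy is, up to complement, the indicator of one or two
rows, that is, of an element of `Sym2`; the `xor` selects the complement that vanishes in row 0. -/
theorem two_pow_le_card_heavyColumns (k : ℕ) :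
    2 ^ k ≤ (heavyColumns k).card + (k + 2).choose 2 := by
  have h0 : (Finset.univ.filter fun c : Fin (k + 1) → Bool => c 0 = false).card = 2 ^ k := by
    have : (Finset.univ.filter fun c : Fin (k + 1) → Bool => c 0 = false)
        = Finset.univ.map ⟨fun v : Fin k → Bool => (Fin.cons false v : Fin (k + 1) → Bool),
          Fin.cons_right_injective (α := fun _ => Bool) false⟩ := by
      ext c
      simp only [Finset.mem_filter, Finset.mem_univ, true_and, Finset.mem_map,
        Function.Embedding.coeFn_mk]
      constructor
      · intro h
        exact ⟨Fin.tail c, by rw [← h]; exact Fin.cons_self_tail c⟩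
      · rintro ⟨v, rfl⟩
        simp
    rw [this, Finset.card_map]
    simp
  have h1 : (Finset.univ.filter fun c : Fin (k + 1) → Bool => c 0 = false) ⊆ heavyColumns k ∪
      Finset.univ.image fun z : Sym2 (Fin (k + 1)) => fun r =>
        xor (decide (r ∈ z)) (decide (0 ∈ z)) := by
    intro c hc
    simp only [Finset.mem_filter, Finset.mem_univ, true_and] at hc
    simp only [Finset.mem_union, Finset.mem_image, Finset.mem_univ, true_and, heavyColumns,
      Finset.mem_filter, hc]
    by_contra! hcon
    obtain ⟨h2, h3⟩ := hcon
    have hw := weight_not c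
    by_cases h4 : weight c = 1 ∨ weight c = 2
    · obtain ⟨z, hz⟩ := exists_sym2_of_weight c h4
      apply h3 z
      funext r
      rw [← hz, ← hz, hc, Bool.xor_false]
    · have h5 : weight (fun r => !c r) = 1 ∨ weight (fun r => !c r) = 2 := by
        by_contra h6
        have := h2 (by omega) (by omega) (by omega); omega
      obtain ⟨z, hz⟩ := exists_sym2_of_weight _ h5
      apply h3 z
      funext r
      rw [← hz, ← hz, hc]
      simp
  calc 2 ^ k = _ := h0.symm
    _ ≤ _ := Finset.card_le_card h1
    _ ≤ _ := Finset.card_union_le _ _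
    _ ≤ _ := by
      gcongr
      refine Finset.card_image_le.trans ?_
      rw [Finset.card_univ, Sym2.card, Fintype.card_fin]

/-- With at least five rows, the weights 1 and 2 of the path columns differ from those of their
complements and of the heavy padding. A symmetry therefore preserves the path, and its only
singleton is fixed. -/
theorem hasAsymmetric_path {k n : ℕ} (hk : 4 ≤ k) (hn : k ≤ n)
    (hn' : n + (k + 2).choose 2 ≤ 2 ^ k + k) : HasAsymmetric (k + 1) n := by
  obtain ⟨P, hP, hPcard⟩ := Finset.exists_subset_card_eq (s := heavyColumns k) (n := n - k)
    (by have := two_pow_le_card_heavyColumns k; omega)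
  have hP' : ∀ c ∈ P, c 0 = false ∧
      weight c ≠ 1 ∧ weight c ≠ 2 ∧ weight c + 1 ≠ k + 1 ∧ weight c + 2 ≠ k + 1 :=
    fun c hc => by simpa [heavyColumns] using hP hc
  set core := (Finset.range k).image (pathColumn (k + 1))
  have hcore : ∀ c, c ∈ core ↔ ∃ i < k, pathColumn (k + 1) i = c := by simp [core]
  have hw : ∀ c ∈ core, weight c = 1 ∨ weight c = 2 := by
    intro c hc
    obtain ⟨i, hi, rfl⟩ := (hcore c).mp hc
    rw [weight_pathColumn (by omega)]
    split_ifs <;> simp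
  have hcard : (core ∪ P).card = n := by
    rw [Finset.card_union_of_disjoint, hPcard, Finset.card_image_of_injOn, Finset.card_range]
    · omega
    · intro i hi j hj h
      simp only [Finset.coe_range, Set.mem_Iio] at hi hj
      exact pathColumn_injective (by omega) (by omega) h
    · rw [Finset.disjoint_left]
      intro c hc hcP
      have := hw c hc
      have := hP' c hcP
      omega
  rw [← hcard]
  apply hasAsymmetric_of_columns
  · intro c hc hnc
    rw [Finset.mem_union] at hc hnc
    have hsum := weight_not c
    rcases hc with hc | hc <;> rcases hnc with hnc | hnc
    · have := hw _ hc; have := hw _ hnc; omega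
    · have := hw _ hc; have := hP' _ hnc; omega
    · have := hP' _ hc; have := hw _ hnc; omega
    · have h1 := (hP' _ hc).1
      have h2 := (hP' _ hnc).1
      simp [h1] at h2
  · intro σ hσ
    apply eq_one_of_maps_pathColumn
    intro i hi
    have hi' : i < k := by omega
    have hmem : pathColumn (k + 1) i ∈ core := (hcore _).mpr ⟨i, hi', rfl⟩
    have hwi := hw _ hmem
    have hwσ := weight_comp (pathColumn (k + 1) i) σ
    have hsum := weight_not (pathColumn (k + 1) i ∘ σ)
    rcases hσ _ (Finset.mem_union_left _ hmem) with h | h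
    · rw [Finset.mem_union] at h
      rcases h with h | h
      · obtain ⟨j, hj, hji⟩ := (hcore _).mp h
        refine ⟨j, ?_, hji.symm⟩
        rw [← hji, weight_pathColumn (by omega), weight_pathColumn (by omega)] at hwσ
        split_ifs at hwσ <;> omega
      · have := hP' _ h; omega
    · change (fun r => !(pathColumn (k + 1) i ∘ σ) r) ∈ _ at h
      rw [Finset.mem_union] at h
      rcases h with h | h
      · have := hw _ h; omega
      · have := hP' _ h; omega

/-- Makes `hasAsymmetric_path` available for all `n` from `k` to `2 ^ (k - 1)`. It fails for `k =
4`, so five rows need separate matrices. -/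
theorem choose_two_add_le_two_pow {k : ℕ} (hk : 5 ≤ k) : (k + 2).choose 2 ≤ 2 ^ (k - 1) + k := by
  induction k, hk using Nat.le_induction with
  | base => decide
  | succ k hk ih =>
    have h1 : (k + 1 + 2).choose 2 = (k + 2) + (k + 2).choose 2 := by
      rw [show k + 1 + 2 = (k + 2) + 1 by ring, Nat.choose_succ_succ' (k + 2) 1, Nat.choose_one_right]
    have h2 : k - 2 < 2 ^ (k - 2) := Nat.lt_two_pow_self
    have h2' : 2 ^ (k - 1) = 2 ^ (k - 2) + 2 ^ (k - 2) := by
      rw [← two_mul, ← pow_succ']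
      congr 1
      omega
    have h3 : 2 ^ (k + 1 - 1) = 2 ^ (k - 1) + 2 ^ (k - 1) := by
      rw [← two_mul, ← pow_succ']
      congr 1
      omega
    omega

/-! ### Padding with singletons, and spread sets -/

/-- A matrix without singleton columns that has no nontrivial symmetry remains asymmetric when
distinct singleton columns are added. -/
theorem hasAsymmetric_add_singletons {k n : ℕ} (X : Fin k → Fin n → Bool) (hk : 3 ≤ k)
    (hw : ∀ j, 2 ≤ weight (fun r => X r j) ∧ 2 * weight (fun r => X r j) < k)
    (hcol : Function.Injective fun j r => X r j)
    (hσ : ∀ σ : Equiv.Perm (Fin k), (∀ j, ∃ l, ∀ r, X (σ r) j = X r l) → σ = 1)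
    {m : ℕ} (hm : n ≤ m) (hm' : m ≤ n + k) : HasAsymmetric k m := by
  obtain ⟨k, rfl⟩ : ∃ l, k = l + 1 := ⟨k - 1, by omega⟩
  obtain ⟨P, -, hPcard⟩ := Finset.exists_subset_card_eq (s := (Finset.univ : Finset (Fin (k + 1))))
    (n := m - n) (by simp; omega)
  have hsingle : ∀ i : Fin (k + 1), weight (fun r => decide (r = i)) = 1 := by
    intro i
    simp [weight, Finset.filter_eq']
  set core : Finset (Fin (k + 1) → Bool) := Finset.univ.image fun j r => X r j
  set sing : Finset (Fin (k + 1) → Bool) := P.image fun i r => decide (r = i)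
  have hs : ∀ c ∈ sing, weight c = 1 := by
    intro c hc
    obtain ⟨i, -, rfl⟩ := Finset.mem_image.mp hc
    exact hsingle i
  have hc2 : ∀ c ∈ core, 2 ≤ weight c ∧ 2 * weight c < k + 1 := by
    intro c hc
    obtain ⟨j, -, rfl⟩ := Finset.mem_image.mp hc
    exact hw j
  -- All weights are below half, so no column is carried to the complement of another, and weight
  -- separates `core` from `sing`.
  have hlt : ∀ c ∈ core ∪ sing, 2 * weight c < k + 1 := by
    intro c hc
    rcases Finset.mem_union.mp hc with h | h
    · exact (hc2 c h).2
    · have := hs c h; omega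
  have hcard : (core ∪ sing).card = m := by
    rw [Finset.card_union_of_disjoint, Finset.card_image_of_injective _ hcol,
      Finset.card_image_of_injective, hPcard]
    · simp; omega
    · intro i j hij
      simpa using congrFun hij i
    · rw [Finset.disjoint_left]
      intro c h1 h2
      have := hs c h2
      have := hc2 c h1
      omega
  rw [← hcard]
  apply hasAsymmetric_of_columns
  · intro c hc hnc
    have := hlt _ hc
    have := hlt _ hnc
    have := weight_not c
    omega
  · intro σ h
    apply hσ
    intro j
    have hmem : (fun r => X r j) ∈ core := Finset.mem_image_of_mem _ (Finset.mem_univ j)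
    have hwσ := weight_comp (fun r => X r j) σ
    have hwj := hw j
    rcases h _ (Finset.mem_union_left _ hmem) with h | h
    · rcases Finset.mem_union.mp h with h | h
      · obtain ⟨l, -, hl⟩ := Finset.mem_image.mp h
        exact ⟨l, fun r => (congrFun hl r).symm⟩
      · have := hs _ h
        omega
    · have h1 := hlt _ h
      have h2 := weight_not ((fun r => X r j) ∘ σ)
      change 2 * weight (fun r => !((fun r => X r j) ∘ σ) r) < _ at h1
      omega

/-- Distinct rows make `σ` recoverable from the induced map of columns, so a search over the few
weight-preserving column maps replaces one over row permutations. -/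
theorem hasAsymmetric_of_check {k n : ℕ} (X : Fin k → Fin n → Bool) (w : Fin n → ℕ) (hk : 3 ≤ k)
    (hX : Function.Injective X) (hw : ∀ j, weight (fun r => X r j) = w j)
    (hw' : ∀ j, 2 ≤ w j ∧ 2 * w j < k)
    (hcol : Function.Injective fun j r => X r j)
    (hf : ∀ f : Fin n → Fin n, (∀ j, w (f j) = w j) → Function.Injective f →
      (∀ r, ∃ s, ∀ j, X s j = X r (f j)) → ∀ j, f j = j)
    {m : ℕ} (hm : n ≤ m) (hm' : m ≤ n + k) : HasAsymmetric k m := by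
  refine hasAsymmetric_add_singletons X hk (fun j => by rw [hw]; exact hw' j) hcol ?_ hm hm'
  intro σ hσ
  choose f h using hσ
  have hfj := hf f (fun j => ?_) (fun i j hij => hcol (funext fun r => ?_))
    (fun r => ⟨σ r, fun j => h j r⟩)
  · ext1 r
    apply hX
    funext j
    rw [h, hfj]; rfl
  · rw [← hw, ← hw, ← weight_comp (fun r => X r j) σ]
    congr 1
    funext r
    exact (h j r).symm
  · change X r i = X r j
    rw [← σ.apply_symm_apply r, h, h, hij]

/-- The number of elements of `S` with a one in position `j`. -/
def columnWeight {n : ℕ} (S : Finset (Fin n → Bool)) (j : Fin n) : ℕ :=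
  (S.filter fun v => v j = true).card

/-- The columns of `S` have distinct weights, at least two and below half of the number of rows. -/
def IsSpread {n : ℕ} (S : Finset (Fin n → Bool)) : Prop :=
  Function.Injective (columnWeight S) ∧ ∀ j, 2 ≤ columnWeight S j ∧ 2 * columnWeight S j < S.card

theorem IsSpread.hasAsymmetric {n : ℕ} {S : Finset (Fin n → Bool)} (hS : IsSpread S)
    (hk : 3 ≤ S.card) {m : ℕ} (hm : n ≤ m) (hm' : m ≤ n + S.card) :
    HasAsymmetric S.card m := by
  let e := S.equivFin.symm
  have hweight : ∀ j, weight (fun r => (e r : Fin n → Bool) j) = columnWeight S j := by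
    intro j
    apply Finset.card_bij (fun r _ => (e r : Fin n → Bool))
    · intro r hr
      simpa using hr
    · intro r _ s _ h
      exact e.injective (Subtype.ext h)
    · intro v hv
      rw [Finset.mem_filter] at hv
      refine ⟨e.symm ⟨v, hv.1⟩, ?_, ?_⟩ <;> simp [hv.2]
  refine hasAsymmetric_of_check (fun r => (e r : Fin n → Bool)) (columnWeight S) hk ?_ ?_ hS.2 ?_ ?_
    hm hm'
  · exact fun r s h => e.injective (Subtype.ext h)
  · exact hweight
  · intro i j hij
    apply hS.1
    rw [← hweight, ← hweight]
    exact congrArg weight hij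
  · exact fun f hf _ _ j => hS.1 (hf j)

/-- Some spread set of binary strings of length `n` has `k` elements. -/
def HasSpread (k n : ℕ) : Prop := ∃ S : Finset (Fin n → Bool), IsSpread S ∧ S.card = k

/-- Adding an antipodal pair raises every column weight by one and the size by two. If `S` met every
such pair, it would have at least `2 ^ n` elements. -/
theorem HasSpread.add_two {k n : ℕ} (h : HasSpread k (n + 1)) (hk : k < 2 ^ n) :
    HasSpread (k + 2) (n + 1) := by
  obtain ⟨S, hS, rfl⟩ := h
  obtain ⟨v, hv, hv'⟩ : ∃ v, v ∉ S ∧ (fun i => !v i) ∉ S := by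
    by_contra! hcon
    have hinj : Function.Injective fun (v : Fin (n + 1) → Bool) i => !v i :=
      fun v w h => funext fun i => by simpa using congrFun h i
    have : (Finset.univ : Finset (Fin (n + 1) → Bool)) ⊆ S ∪ S.image fun v i => !v i := by
      intro v _
      rw [Finset.mem_union]
      by_cases hv : v ∈ S
      · exact Or.inl hv
      · exact Or.inr (Finset.mem_image.mpr ⟨_, hcon v hv, by simp⟩)
    have := (Finset.card_le_card this).trans (Finset.card_union_le _ _)
    rw [Finset.card_image_of_injective _ hinj] at this
    simp only [Finset.card_univ, Fintype.card_pi, Fintype.card_bool, Finset.prod_const,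
      Fintype.card_fin, pow_succ] at this
    omega
  have hne : v ≠ fun i => !v i := fun h => by
    have := congrFun h 0
    simp at this
  have hv2 : v ∉ insert (fun i => !v i) S := by simp [hv, hne]
  have hcol : ∀ j, columnWeight (insert v (insert (fun i => !v i) S)) j = columnWeight S j + 1 := by
    intro j
    simp only [columnWeight, Finset.filter_insert]
    by_cases hj : v j = true
    · simp [hj, hv]
    · simp [hj, hv']
  have hcard : (insert v (insert (fun i => !v i) S)).card = S.card + 2 := by
    rw [Finset.card_insert_of_notMem hv2, Finset.card_insert_of_notMem hv']
  refine ⟨_, ⟨fun i j hij => ?_, fun j => ?_⟩, hcard⟩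
  · rw [hcol, hcol] at hij
    exact hS.1 (by omega)
  · rw [hcol, hcard]
    have := hS.2 j
    omega

/-- One of the `n + 1` values from 2 to `n + 2` is not yet a column weight; the size bound keeps it
below half. -/
theorem HasSpread.add_column {k n : ℕ} (h : HasSpread k n) (hk : 2 * n + 5 ≤ k) :
    HasSpread k (n + 1) := by
  obtain ⟨S, hS, rfl⟩ := h
  obtain ⟨w, hw, hw'⟩ : ∃ w ∈ Finset.Ico 2 (n + 3), w ∉ Finset.univ.image (columnWeight S) := by
    apply Finset.exists_mem_notMem_of_card_lt_card
    refine Finset.card_image_le.trans_lt ?_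
    simp
  rw [Finset.mem_Ico] at hw
  have hw' : ∀ j, columnWeight S j ≠ w := by simpa using hw'
  obtain ⟨A, hA, hAcard⟩ := Finset.exists_subset_card_eq (s := S) (n := w) (by omega)
  have hinj : Function.Injective fun v : Fin n → Bool =>
      (Fin.cons (decide (v ∈ A)) v : Fin (n + 1) → Bool) := by
    intro u v huv
    exact (Fin.cons_injective2 (α := fun _ => Bool) huv).2
  have hcard : (S.map ⟨_, hinj⟩).card = S.card := Finset.card_map _
  have h0 : columnWeight (S.map ⟨_, hinj⟩) 0 = w := by
    simp only [columnWeight, Finset.filter_map, Finset.card_map]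
    rw [← hAcard]
    congr 1
    ext v
    simp only [Finset.mem_filter, Function.comp_apply, Function.Embedding.coeFn_mk, Fin.cons_zero,
      decide_eq_true_eq]
    exact ⟨fun h => h.2, fun h => ⟨hA h, h⟩⟩
  have hsucc : ∀ j : Fin n, columnWeight (S.map ⟨_, hinj⟩) j.succ = columnWeight S j := by
    intro j
    simp only [columnWeight, Finset.filter_map, Finset.card_map]
    rfl
  refine ⟨_, ⟨fun i j => ?_, fun j => ?_⟩, hcard⟩
  · refine Fin.cases ?_ (fun i => ?_) i <;> refine Fin.cases ?_ (fun j => ?_) j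
    · simp
    · rw [h0, hsucc]
      exact fun h => absurd h.symm (hw' j)
    · rw [h0, hsucc]
      exact fun h => absurd h (hw' i)
    · rw [hsucc, hsucc]
      exact fun h => congrArg Fin.succ (hS.1 h)
  · rw [hcard]
    refine Fin.cases ?_ (fun j => ?_) j
    · rw [h0]; omega
    · rw [hsucc]; exact hS.2 j

/-! ### Explicit small matrices -/

theorem hasAsymmetric_of_check_five {k : ℕ} (X : Fin k → Fin 5 → Bool) (w : Fin 5 → ℕ) (hk : 3 ≤ k)
    (hX : Function.Injective X) (hw : ∀ j, weight (fun r => X r j) = w j)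
    (hw' : ∀ j, 2 ≤ w j ∧ 2 * w j < k)
    (hcol : Function.Injective fun j r => X r j)
    (hf : ∀ a, w a = w 0 → ∀ b, w b = w 1 → ∀ c, w c = w 2 → ∀ d, w d = w 3 → ∀ e, w e = w 4 →
      Function.Injective ![a, b, c, d, e] → (∀ r, ∃ s, ∀ j, X s j = X r (![a, b, c, d, e] j)) →
        ∀ j, ![a, b, c, d, e] j = j)
    {m : ℕ} (hm : 5 ≤ m) (hm' : m ≤ 5 + k) : HasAsymmetric k m := by
  refine hasAsymmetric_of_check X w hk hX hw hw' hcol (fun f h1 h2 h3 => ?_) hm hm'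
  have e : f = ![f 0, f 1, f 2, f 3, f 4] := by
    funext j
    fin_cases j <;> rfl
  rw [e] at h2 h3 ⊢
  exact hf _ (h1 0) _ (h1 1) _ (h1 2) _ (h1 3) _ (h1 4) h2 h3

-- Each listed number encodes a row by its binary digits; the second vector gives the column
-- weights. The upper bound on `n` is the number of core columns plus one singleton for each row.
set_option maxRecDepth 100000 in
theorem hasAsymmetric_seven {n : ℕ} (h : 4 ≤ n) (h' : n ≤ 11) : HasAsymmetric 7 n :=
  hasAsymmetric_of_check (n := 4)
    (fun r j => Nat.testBit (![0, 3, 4, 5, 8, 9, 10] r) j)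
    ![3, 2, 2, 3] (by decide) (by decide) (by decide) (by decide) (by decide) (by decide) h h'

set_option maxRecDepth 100000 in
theorem hasAsymmetric_eight {n : ℕ} (h : 4 ≤ n) (h' : n ≤ 12) : HasAsymmetric 8 n :=
  hasAsymmetric_of_check (n := 4)
    (fun r j => Nat.testBit (![0, 1, 3, 4, 6, 8, 9, 14] r) j)
    ![3, 3, 3, 3] (by decide) (by decide) (by decide) (by decide) (by decide) (by decide) h h'

set_option maxRecDepth 100000 in
theorem hasAsymmetric_nine {n : ℕ} (h : 5 ≤ n) (h' : n ≤ 14) : HasAsymmetric 9 n :=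
  hasAsymmetric_of_check_five
    (fun r j => Nat.testBit (![0, 1, 3, 4, 6, 10, 12, 20, 26] r) j)
    ![2, 4, 4, 3, 2] (by decide) (by decide) (by decide) (by decide) (by decide) (by decide) h h'

set_option maxRecDepth 100000 in
theorem hasAsymmetric_ten {n : ℕ} (h : 5 ≤ n) (h' : n ≤ 15) : HasAsymmetric 10 n :=
  hasAsymmetric_of_check_five
    (fun r j => Nat.testBit (![0, 1, 2, 4, 6, 10, 14, 16, 21, 24] r) j)
    ![2, 4, 4, 3, 3] (by decide) (by decide) (by decide) (by decide) (by decide) (by decide) h h'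

set_option maxRecDepth 100000 in
theorem hasAsymmetric_eleven {n : ℕ} (h : 5 ≤ n) (h' : n ≤ 16) : HasAsymmetric 11 n :=
  hasAsymmetric_of_check_five
    (fun r j => Nat.testBit (![0, 1, 2, 4, 9, 10, 16, 17, 18, 21, 26] r) j)
    ![4, 4, 2, 3, 5] (by decide) (by decide) (by decide) (by decide) (by decide) (by decide) h h'

set_option maxRecDepth 100000 in
theorem hasAsymmetric_twelve {n : ℕ} (h : 5 ≤ n) (h' : n ≤ 17) : HasAsymmetric 12 n :=
  hasAsymmetric_of_check_five
    (fun r j => Nat.testBit (![0, 1, 2, 4, 5, 6, 8, 10, 16, 18, 19, 20] r) j)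
    ![3, 5, 4, 2, 4] (by decide) (by decide) (by decide) (by decide) (by decide) (by decide) h h'

set_option maxRecDepth 100000 in
theorem hasAsymmetric_thirteen {n : ℕ} (h : 5 ≤ n) (h' : n ≤ 18) : HasAsymmetric 13 n :=
  hasAsymmetric_of_check_five
    (fun r j => Nat.testBit (![0, 1, 2, 4, 5, 6, 8, 9, 10, 12, 14, 16, 24] r) j)
    ![3, 4, 5, 6, 2] (by decide) (by decide) (by decide) (by decide) (by decide) (by decide) h h'

set_option maxRecDepth 100000 in
theorem hasAsymmetric_fourteen {n : ℕ} (h : 5 ≤ n) (h' : n ≤ 19) : HasAsymmetric 14 n :=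
  hasAsymmetric_of_check_five
    (fun r j => Nat.testBit (![0, 1, 2, 3, 4, 5, 6, 8, 9, 11, 12, 17, 18, 20] r) j)
    ![6, 5, 5, 4, 3] (by decide) (by decide) (by decide) (by decide) (by decide) (by decide) h h'

set_option maxRecDepth 100000 in
theorem hasAsymmetric_fifteen {n : ℕ} (h : 5 ≤ n) (h' : n ≤ 20) : HasAsymmetric 15 n :=
  hasAsymmetric_of_check_five
    (fun r j => Nat.testBit (![0, 1, 2, 4, 6, 8, 9, 10, 12, 13, 14, 16, 18, 20, 24] r) j)
    ![3, 5, 6, 7, 4] (by decide) (by decide) (by decide) (by decide) (by decide) (by decide) h h'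

set_option maxRecDepth 100000 in
theorem hasAsymmetric_sixteen {n : ℕ} (h : 5 ≤ n) (h' : n ≤ 21) : HasAsymmetric 16 n :=
  hasAsymmetric_of_check_five
    (fun r j => Nat.testBit (![0, 1, 2, 3, 4, 5, 7, 8, 10, 16, 17, 18, 20, 21, 25, 28] r) j)
    ![7, 5, 6, 4, 7] (by decide) (by decide) (by decide) (by decide) (by decide) (by decide) h h'

-- For five rows the only heavy column is zero, so the path construction stops at five columns. Here
-- the whole path is used, with singletons that break its reflection.
set_option maxRecDepth 100000 in
theorem hasAsymmetric_five_six : HasAsymmetric 5 6 := by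
  have := hasAsymmetric_of_columns (k := 4)
    ([[0],[0,1],[1,2],[2,3],[3,4],[]].map (fun l (r : Fin 5) => l.contains r.1)).toFinset (by decide)
    (by decide)
  exact this

set_option maxRecDepth 100000 in
theorem hasAsymmetric_five_seven : HasAsymmetric 5 7 := by
  have := hasAsymmetric_of_columns (k := 4)
    ([[0],[1],[0,1],[1,2],[2,3],[3,4],[]].map (fun l (r : Fin 5) => l.contains r.1)).toFinset (by decide)
    (by decide)
  exact this

set_option maxRecDepth 100000 in
theorem hasAsymmetric_five_eight : HasAsymmetric 5 8 := by
  have := hasAsymmetric_of_columns (k := 4)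
    ([[0],[1],[2],[0,1],[1,2],[2,3],[3,4],[]].map (fun l (r : Fin 5) => l.contains r.1)).toFinset (by decide)
    (by decide)
  exact this

/-- Needed for six rows and four columns: the matrix used there has a column of weight three, which
weight cannot tell from its complement. -/
theorem hasAsymmetric_of_signed_check {k n : ℕ} (X : Fin k → Fin n → Bool)
    (hX : Function.Injective X)
    (hf : ∀ f : Fin n → Fin n, Function.Injective f → ∀ g : Fin n → Bool,
      (∀ r, ∃ s, ∀ j, X s j = xor (X r (f j)) (g j)) → ∀ j, f j = j ∧ g j = false) :
    HasAsymmetric k n := by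
  refine ⟨X, fun σ φ h => ?_⟩
  replace h := (isSymmetry_iff _ _ _).mp h
  have hψ : ∀ j b, φ.ψ j b = xor b (φ.ψ j false) := by
    intro j
    generalize φ.ψ j = p
    revert p
    decide
  have hfix := hf φ.π.symm φ.π.symm.injective (fun j => φ.ψ (φ.π.symm j) false) fun r => ⟨σ.symm r, fun j => by
    rw [← hψ, h]; rfl⟩
  have hact : ∀ v, φ.act v = v := fun v => funext fun j => by
    have := hfix j
    change φ.ψ (φ.π.symm j) (v (φ.π.symm j)) = v j
    rw [hψ, this.2, this.1, Bool.xor_false]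
  refine ⟨?_, φ.eq_id_of_act hact⟩
  ext1 r
  have := h (σ r)
  rw [hact, σ.symm_apply_apply] at this
  exact (hX this).symm

set_option maxRecDepth 100000 in
theorem hasAsymmetric_six_four : HasAsymmetric 6 4 :=
  hasAsymmetric_of_signed_check (fun r j => Nat.testBit (![0, 1, 2, 3, 4, 13] r) j)
    (by decide) (by decide)

set_option maxRecDepth 100000 in
theorem hasSpread_fifteen_six : HasSpread 15 6 :=
  ⟨([0, 1, 2, 6, 8, 16, 17, 20, 32, 36, 40, 44, 48, 56, 58].map
    fun c (j : Fin 6) => Nat.testBit c j).toFinset, ⟨by decide, by decide⟩, by decide⟩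

set_option maxRecDepth 100000 in
theorem hasSpread_sixteen_six : HasSpread 16 6 :=
  ⟨([0, 1, 2, 8, 12, 16, 18, 20, 24, 32, 34, 36, 37, 40, 48, 56].map
    fun c (j : Fin 6) => Nat.testBit c j).toFinset, ⟨by decide, by decide⟩, by decide⟩

/-! ### Spread sets of all sizes, and matrices with more rows than columns -/

theorem two_mul_add_six_le_two_pow {n : ℕ} (hn : 6 ≤ n) : 2 * n + 6 ≤ 2 ^ (n - 1) := by
  induction n, hn using Nat.le_induction with
  | base => norm_num
  | succ n hn ih =>
    have : 2 ^ (n + 1 - 1) = 2 ^ (n - 1) + 2 ^ (n - 1) := by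
      rw [← two_mul, ← pow_succ']
      congr 1
      omega
    omega

/-- The bound `2 * n + 3` is forced: `n` distinct weights from 2 on reach `n + 1`, which must lie
below half. Small sizes are inherited by adding a column, larger ones by steps of two; the seeds 15
and 16 provide both parities. -/
theorem hasSpread {n k : ℕ} (hn : 6 ≤ n) (hk : 15 ≤ k) (hk' : 2 * n + 3 ≤ k)
    (hk2 : k ≤ 2 ^ (n - 1)) : HasSpread k n := by
  induction n, hn using Nat.le_induction generalizing k with
  | base =>
    induction k using Nat.strong_induction_on with
    | _ k ih =>
    obtain rfl | rfl | h : k = 15 ∨ k = 16 ∨ 17 ≤ k := by omega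
    · exact hasSpread_fifteen_six
    · exact hasSpread_sixteen_six
    · obtain ⟨l, rfl⟩ : ∃ l, k = l + 2 := ⟨k - 2, by omega⟩
      norm_num at hk2
      exact (ih l (by omega) (by omega) (by omega) (by norm_num; omega)).add_two (by norm_num; omega)
  | succ n hn ihn =>
    have h6 := two_mul_add_six_le_two_pow hn
    simp only [Nat.add_sub_cancel] at hk2
    induction k using Nat.strong_induction_on with
    | _ k ih =>
    rcases Nat.lt_or_ge (2 ^ (n - 1)) k with h | h
    · obtain ⟨l, rfl⟩ : ∃ l, k = l + 2 := ⟨k - 2, by omega⟩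
      exact (ih l (by omega) (by omega) (by omega) (by omega)).add_two (by omega)
    · exact (ihn hk (by omega) h).add_column (by omega)

theorem hasAsymmetric_of_lt {n k : ℕ} (hn : 5 ≤ n) (hnk : n < k) (hk : k ≤ 2 ^ (n - 1)) :
    HasAsymmetric k n := by
  rcases Nat.lt_or_ge k 17 with h | h
  · obtain rfl | rfl | rfl | rfl | rfl | rfl | rfl | rfl | rfl | rfl | rfl :
      k = 6 ∨ k = 7 ∨ k = 8 ∨ k = 9 ∨ k = 10 ∨ k = 11 ∨ k = 12 ∨ k = 13 ∨ k = 14 ∨ k = 15 ∨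
        k = 16 := by omega
    · obtain rfl : n = 5 := by omega
      exact hasAsymmetric_path (by norm_num) (by norm_num) (by decide)
    · exact hasAsymmetric_seven (by omega) (by omega)
    · exact hasAsymmetric_eight (by omega) (by omega)
    · exact hasAsymmetric_nine (by omega) (by omega)
    · exact hasAsymmetric_ten (by omega) (by omega)
    · exact hasAsymmetric_eleven (by omega) (by omega)
    · exact hasAsymmetric_twelve (by omega) (by omega)
    · exact hasAsymmetric_thirteen (by omega) (by omega)
    · exact hasAsymmetric_fourteen (by omega) (by omega)
    · exact hasAsymmetric_fifteen (by omega) (by omega)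
    · exact hasAsymmetric_sixteen (by omega) (by omega)
  · have hn6 : 6 ≤ n := by
      by_contra hcon
      obtain rfl : n = 5 := by omega
      norm_num at hk
      omega
    have key : ∀ l, l ≤ n → HasSpread k l → HasAsymmetric k n := by
      rintro l hl ⟨S, hS, rfl⟩
      exact hS.hasAsymmetric (by omega) hl (by omega)
    rcases Nat.lt_or_ge k (2 * n + 3) with h2 | h2
    -- `(k - 3) / 2` is the largest number of columns that a spread set of size `k` can have;
    -- singletons supply the rest.
    · have h6 := two_mul_add_six_le_two_pow (n := (k - 3) / 2) (by omega)
      exact key ((k - 3) / 2) (by omega) (hasSpread (by omega) (by omega) (by omega) (by omega))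
    · exact key n le_rfl (hasSpread hn6 (by omega) h2 hk)

theorem hasAsymmetric_five_four : HasAsymmetric 5 4 :=
  hasAsymmetric_path (by norm_num) (by norm_num) (by decide)

/-! ### The cost and the range of attained sizes -/

theorem succ_le_two_pow_pred {n : ℕ} (hn : 4 ≤ n) : n + 1 ≤ 2 ^ (n - 1) := by
  induction n, hn using Nat.le_induction with
  | base => norm_num
  | succ n hn ih =>
    have : 2 ^ (n + 1 - 1) = 2 ^ (n - 1) + 2 ^ (n - 1) := by
      rw [← two_mul, ← pow_succ']
      congr 1
      omega
    omega

theorem hasAsymmetric_cost {n : ℕ} (hn : 4 ≤ n) : HasAsymmetric (cost (Q n)) n := by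
  rw [cost_Q]
  have hne : {k | HasAsymmetric k n}.Nonempty := by
    rcases Nat.lt_or_ge 4 n with h | h
    · exact ⟨n + 1, hasAsymmetric_of_lt h (by omega) (succ_le_two_pow_pred hn)⟩
    · obtain rfl : n = 4 := by omega
      exact ⟨5, hasAsymmetric_five_four⟩
  exact Nat.sInf_mem hne

theorem cost_le {n k : ℕ} (h : HasAsymmetric k n) : cost (Q n) ≤ k := by
  rw [cost_Q]
  exact Nat.sInf_le h

theorem cost_add_le {n k : ℕ} (h : HasAsymmetric k n) : k + cost (Q n) ≤ 2 ^ n := by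
  have h1 := cost_le h.compl
  have h2 := h.le_two_pow
  omega

theorem two_mul_cost_le {n : ℕ} (hn : 4 ≤ n) : 2 * cost (Q n) ≤ 2 ^ n := by
  have := cost_add_le (hasAsymmetric_cost hn)
  omega

theorem two_pow_pred_add_self {n : ℕ} (hn : 1 ≤ n) : 2 ^ (n - 1) + 2 ^ (n - 1) = 2 ^ n := by
  rw [← two_mul, ← pow_succ']
  congr 1
  omega

/-- Since `cost - 1 ≤ k - 2`, the column bound at the cost gives `n ≤ 2 ^ (k - 2)`, which fits the
path construction; for `k = 5` only `n ≤ 8` remains. -/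
theorem hasAsymmetric_of_cost_lt {n k : ℕ} (hn : 5 ≤ n) (hk : cost (Q n) < k) (hkn : k ≤ n) :
    HasAsymmetric k n := by
  have h1 : n ≤ 2 ^ (k - 2) := (hasAsymmetric_cost (by omega)).le_two_pow_pred.trans
    (Nat.pow_le_pow_right (by norm_num) (by omega))
  have hk5 : 5 ≤ k := by
    by_contra hcon
    have : 2 ^ (k - 2) ≤ 2 ^ 2 := Nat.pow_le_pow_right (by norm_num) (by omega)
    omega
  rcases Nat.lt_or_ge 5 k with h | h
  · obtain ⟨k, rfl⟩ : ∃ l, k = l + 1 := ⟨k - 1, by omega⟩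
    have h2 := choose_two_add_le_two_pow (k := k) (by omega)
    have h3 := two_pow_pred_add_self (n := k) (by omega)
    rw [show k + 1 - 2 = k - 1 by omega] at h1
    exact hasAsymmetric_path (by omega) (by omega) (by omega)
  · obtain rfl : k = 5 := by omega
    norm_num at h1
    obtain rfl | rfl | rfl | rfl : n = 5 ∨ n = 6 ∨ n = 7 ∨ n = 8 := by omega
    · exact hasAsymmetric_path (by norm_num) (by norm_num) (by decide)
    · exact hasAsymmetric_five_six
    · exact hasAsymmetric_five_seven
    · exact hasAsymmetric_five_eight

/-- For `n ≥ 5` all sizes between the cost and its complement are attained by asymmetric sets. -/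
theorem hasAsymmetric_of_cost_le {n k : ℕ} (hn : 5 ≤ n) (hk : cost (Q n) ≤ k)
    (hk' : k + cost (Q n) ≤ 2 ^ n) : HasAsymmetric k n := by
  have half : ∀ l, cost (Q n) ≤ l → l ≤ 2 ^ (n - 1) → HasAsymmetric l n := by
    intro l h1 h2
    rcases h1.eq_or_lt with rfl | h1
    · exact hasAsymmetric_cost (by omega)
    · rcases Nat.lt_or_ge n l with h | h
      · exact hasAsymmetric_of_lt hn h h2
      · exact hasAsymmetric_of_cost_lt hn h1 h
  have h2 := two_pow_pred_add_self (n := n) (by omega)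
  rcases Nat.lt_or_ge (2 ^ (n - 1)) k with h | h
  · have := (half (2 ^ n - k) (by omega) (by omega)).compl
    rwa [Nat.sub_sub_self (by omega)] at this
  · exact half k hk h

theorem hasAsymmetric_four_columns {k : ℕ} (hk : 5 ≤ k) (hk' : k ≤ 11) : HasAsymmetric k 4 := by
  have half : ∀ l, 5 ≤ l → l ≤ 8 → HasAsymmetric l 4 := by
    intro l h1 h2
    obtain rfl | rfl | rfl | rfl : l = 5 ∨ l = 6 ∨ l = 7 ∨ l = 8 := by omega
    · exact hasAsymmetric_five_four
    · exact hasAsymmetric_six_four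
    · exact hasAsymmetric_seven le_rfl (by norm_num)
    · exact hasAsymmetric_eight le_rfl (by norm_num)
  rcases Nat.lt_or_ge 8 k with h | h
  · have := (half (2 ^ 4 - k) (by omega) (by omega)).compl
    rwa [Nat.sub_sub_self (by omega)] at this
  · exact half k hk h

theorem HasAsymmetric.five_le {k n : ℕ} (h : HasAsymmetric k n) (hn : 3 ≤ n) : 5 ≤ k := by
  have h1 := h.le_two_pow_pred
  by_contra hcon
  obtain rfl | rfl | hk : k = 3 ∨ k = 4 ∨ k ≤ 2 := by omega
  · exact not_hasAsymmetric_three n h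
  · exact not_hasAsymmetric_four n h
  · have : 2 ^ (k - 1) ≤ 2 ^ 1 := Nat.pow_le_pow_right (by norm_num) (by omega)
    omega

/-- With three columns, the complement would have at most three rows, against `five_le`. -/
theorem HasAsymmetric.four_le {k n : ℕ} (h : HasAsymmetric k n) (hk : 5 ≤ k) : 4 ≤ n := by
  by_contra hcon
  have h1 := h.le_two_pow
  rcases Nat.lt_or_ge n 3 with hn | hn
  · have : 2 ^ n ≤ 2 ^ 2 := Nat.pow_le_pow_right (by norm_num) (by omega)
    omega
  · obtain rfl : n = 3 := by omega
    have := h.compl.five_le hn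
    omega

/-! ### The intervals and the value of `nu` -/

theorem nu_eq {m n : ℕ} (h : HasAsymmetric m n) (h' : ∀ l < n, ¬ HasAsymmetric m l) : nu m = n := by
  have hne : {l | HasAsymmetric m l}.Nonempty := ⟨n, h⟩
  apply le_antisymm (Nat.sInf_le h)
  by_contra! hlt
  exact h' _ hlt (Nat.sInf_mem hne)

theorem inInterval_iff {m n : ℕ} :
    InInterval m n ↔ 2 ^ (n - 1) < m + cost (Q (n - 1)) ∧ m + cost (Q n) ≤ 2 ^ n := by
  have h1 : ((2 : ℤ) ^ (n - 1)) = ((2 ^ (n - 1) : ℕ) : ℤ) := by push_cast; rfl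
  have h2 : ((2 : ℤ) ^ n) = ((2 ^ n : ℕ) : ℤ) := by push_cast; rfl
  rw [InInterval, h1, h2]
  omega

/-- The quantity `2 ^ n - cost (Q n)` is at least `2 ^ (n - 1)`, hence nondecreasing; this makes the
intervals disjoint. -/
theorem two_pow_add_cost_le {l n : ℕ} (hl : 4 ≤ l) (hln : l ≤ n) :
    2 ^ l + cost (Q n) ≤ 2 ^ n + cost (Q l) := by
  rcases hln.eq_or_lt with rfl | hln
  · rfl
  · have h1 := two_mul_cost_le (n := n) (by omega)
    have h2 : 2 ^ l ≤ 2 ^ (n - 1) := Nat.pow_le_pow_right (by norm_num) (by omega)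
    have h3 := two_pow_pred_add_self (n := n) (by omega)
    omega

theorem InInterval.eq {m n n' : ℕ} (hn : 5 ≤ n) (hn' : 5 ≤ n') (h : InInterval m n)
    (h' : InInterval m n') : n = n' := by
  have key : ∀ a b, 5 ≤ a → InInterval m a → InInterval m b → ¬ a < b := by
    intro a b ha h1 h2 hab
    rw [inInterval_iff] at h1 h2
    have := two_pow_add_cost_le (l := a) (n := b - 1) (by omega) (by omega)
    omega
  exact le_antisymm (not_lt.mp (key _ _ hn' h' h)) (not_lt.mp (key _ _ hn h h'))

/-- The least `n ≥ 4` whose upper bound reaches `m` works: minimality is the lower bound, and `n =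
4` reaches only 11. -/
theorem exists_inInterval {m : ℕ} (hm : 12 ≤ m) : ∃ n, 5 ≤ n ∧ InInterval m n := by
  classical
  have hex : ∃ n, 4 ≤ n ∧ m + cost (Q n) ≤ 2 ^ n := by
    refine ⟨m, by omega, ?_⟩
    have h1 := two_mul_cost_le (n := m) (by omega)
    have h2 := succ_le_two_pow_pred (n := m) (by omega)
    have h3 := two_pow_pred_add_self (n := m) (by omega)
    omega
  have hspec := Nat.find_spec hex
  have hmin := fun l => Nat.find_min hex (m := l)
  set n := Nat.find hex
  have h5 : 5 ≤ n := by
    by_contra hcon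
    have h4 : n = 4 := by omega
    have h := (hasAsymmetric_cost (n := 4) le_rfl).five_le (by norm_num)
    rw [h4] at hspec
    omega
  refine ⟨n, h5, inInterval_iff.mpr ⟨?_, hspec.2⟩⟩
  have := hmin (n - 1) (by omega)
  by_contra hcon
  exact this ⟨by omega, by omega⟩

theorem InInterval.nu_eq {m n : ℕ} (hm : 12 ≤ m) (hn : 5 ≤ n) (h : InInterval m n) :
    nu m = n := by
  rw [inInterval_iff] at h
  have h1 := two_mul_cost_le (n := n - 1) (by omega)
  have h2 := two_pow_pred_add_self (n := n - 1) (by omega)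
  have h3 := succ_le_two_pow_pred (n := n - 1) (by omega)
  apply Hypercube.nu_eq
  · apply hasAsymmetric_of_cost_le hn _ h.2
    -- It remains to see `cost (Q n) ≤ m`. Either `m` exceeds half of `2 ^ n`, or `n < m ≤ 2 ^ (n -
    -- 1)` and `m` is itself attained.
    rcases Nat.lt_or_ge (2 ^ (n - 1)) m with hlt | hge
    · have h4 := two_mul_cost_le (n := n) (by omega)
      have h5 := two_pow_pred_add_self (n := n) (by omega)
      omega
    · exact cost_le (hasAsymmetric_of_lt hn (by omega) hge)
  · intro l hl hl'
    have h4 := hl'.four_le (by omega)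
    have h5 := cost_add_le hl'
    have h6 := two_pow_add_cost_le (l := l) (n := n - 1) h4 (by omega)
    omega

end Hypercube

theorem mainTheorem2 :
    (∀ m : ℕ, 5 ≤ m → m ≤ 11 → Hypercube.nu m = 4) ∧
    (∀ m : ℕ, 12 ≤ m →
      (∃! n : ℕ, 5 ≤ n ∧ Hypercube.InInterval m n) ∧
      (∀ n : ℕ, 5 ≤ n → Hypercube.InInterval m n → Hypercube.nu m = n)) := by
  refine ⟨fun m h1 h2 => ?_, fun m hm => ⟨?_, fun n hn h => h.nu_eq hm hn⟩⟩
  · apply Hypercube.nu_eq (Hypercube.hasAsymmetric_four_columns h1 h2)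
    intro l hl h
    have := h.four_le h1
    omega
  · obtain ⟨n, hn, h⟩ := Hypercube.exists_inInterval hm
    exact ⟨n, ⟨hn, h⟩, fun n' h' => Hypercube.InInterval.eq h'.1 hn h'.2 h⟩
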